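/- Let $\mathsf{BorelStoch}$ be the Markov category whose objects are standard Borel spaces and whose morphisms $X \to Y$ are measurable Markov kernels, with kernel composition $(g\circ f)(S\mid x)=\int g(S\mid y)\,f(dy\mid x)$, tensor product given by products of spaces and of kernels, and copy morphisms $\mathrm{copy}_X \colon X \to X \otimes X$, $x \mapsto \delta_{(x,x)}$. Let $e \colon X \to X$ be an idempotent in $\mathsf{BorelStoch}$, i.e. a Markov kernel on a standard Borel space $X$ with $e \circ e = e$. Then: 1. $e$ is balanced, i.e. $$(e \otimes \mathrm{id}_X)\circ \mathrm{copy}_X \circ e \;=\; (e \otimes e)\circ \mathrm{copy}_X \circ e ;$$ 2. $e$ splits in $\mathsf{BorelStoch}$, i.e. there are a standard Borel space $T$ and Markov kernels $\pi \colon X \to T$ and $\iota \colon T \to X$ such that $\pi \circ \iota = \mathrm{id}_T$ and $\iota \circ \pi = e$. -/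

import Mathlib

open CategoryTheory MonoidalCategory
open scoped ComonObj

universe u v

/-- An idempotent `e : X ⟶ X` in a Markov category is *balanced* if running two steps of `e`
and recording (on the right) the intermediate value is the same as running `e`, copying the
result, and applying `e` independently to both copies:
`(e ⊗ id) ∘ copy ∘ e = (e ⊗ e) ∘ copy ∘ e`. -/
def IsBalanced {C : Type u} [Category.{v} C] [MonoidalCategory C] [MarkovCategory C]
    {X : C} (e : X ⟶ X) : Prop :=
  e ≫ Δ[X] ≫ (e ⊗ₘ 𝟙 X) = e ≫ Δ[X] ≫ (e ⊗ₘ e)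

/-- A morphism `e : X ⟶ X` *splits* if it factors as `e = ι ∘ π` through an object `T` of the
same category, with `π ∘ ι` the identity of `T`. -/
def Splits {C : Type u} [Category.{v} C] {X : C} (e : X ⟶ X) : Prop :=
  ∃ (T : C) (π : X ⟶ T) (ι : T ⟶ X), ι ≫ π = 𝟙 T ∧ π ≫ ι = e

/-- The property of a measurable space, as an object of `Stoch`, of being standard Borel. -/
def IsStandardBorel : ObjectProperty Stoch.{u} := fun X => StandardBorelSpace X.obj.carrier

instance : (IsStandardBorel.{u}).IsMonoidal where
  prop_unit := show StandardBorelSpace PUnit from inferInstance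
  prop_tensor X Y hX hY := by
    have : StandardBorelSpace X.obj.carrier := hX
    have : StandardBorelSpace Y.obj.carrier := hY
    exact (inferInstance : StandardBorelSpace (X.obj.carrier × Y.obj.carrier))

/-- `BorelStoch`: the category of standard Borel spaces and measurable Markov kernels, as the full
subcategory of `Stoch` (all measurable spaces and Markov kernels) on standard Borel spaces. -/
abbrev BorelStoch := (IsStandardBorel.{u}).FullSubcategory

namespace BorelStoch

/-- Copying and discarding in `BorelStoch` are those of `Stoch`. -/
@[simps]
noncomputable instance (X : BorelStoch.{u}) : ComonObj X where
  counit := ObjectProperty.homMk ε[X.obj]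
  comul := ObjectProperty.homMk Δ[X.obj]
  counit_comul := ObjectProperty.hom_ext _ (ComonObj.counit_comul X.obj)
  comul_counit := ObjectProperty.hom_ext _ (ComonObj.comul_counit X.obj)
  comul_assoc := ObjectProperty.hom_ext _ (ComonObj.comul_assoc X.obj)

noncomputable instance : MarkovCategory BorelStoch.{u} where
  isCommComonObj X := ⟨ObjectProperty.hom_ext _ (IsCommComonObj.comul_comm X.obj)⟩
  copy_tensor X Y := ObjectProperty.hom_ext _ (CopyDiscardCategory.copy_tensor X.obj Y.obj)
  discard_tensor X Y := ObjectProperty.hom_ext _ (CopyDiscardCategory.discard_tensor X.obj Y.obj)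
  copy_unit := ObjectProperty.hom_ext _ CopyDiscardCategory.copy_unit
  discard_unit := ObjectProperty.hom_ext _ CopyDiscardCategory.discard_unit
  discard_natural f := ObjectProperty.hom_ext _ (MarkovCategory.discard_natural f.hom)

end BorelStoch

/-!
Write `e x` for the law of one step of `e` from `x`. Idempotence says both that `e x` is a
stationary law for `e` and that `y ↦ e y A` is harmonic for every measurable `A`. A bounded harmonic
function `g` is almost surely constant along a stationary step `(y, z)`, since
`E (g z - g y)² = E (g z)² - 2 E (g y)² + E (g y)² = 0` (`ae_real_eq_of_idempotent`). As a
probability measure on a standard Borel space is determined by countably many of its values, for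
`e x`-almost every `y` the law `e z` equals `e y` for `e y`-almost every `z`
(`ae_ae_lawCode_eq`). The balance equation follows by drawing the first point in two steps
(`balanced_of_idempotent`).

For the splitting, let `T` be the set of probability measures `ν` on `X` such that `e z = ν` for
`ν`-almost every `z`. Each such `ν` is some `e z`, and for every `x` almost every `y` drawn from
`e x` has `e y ∈ T`. Let `π x` be the law of `e y` for `y` drawn from `e x`, and let `ι ν` be `ν`.
Then `ι ∘ π = e ∘ e = e`, and `π ∘ ι` is the identity because `e z = ν` holds `ν`-almost surely
(`exists_splitting_of_idempotent`).

To have `T` as a standard Borel space, `X` is embedded in `ℝ` and a measure on `ℝ` is encoded by its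
cumulative distribution function on the rationals, a point of a countable power of `ℝ`. The measure
is a measurable function of its code (`decodeKernel`), so the defining condition of `T` makes sense
on codes and is measurable (`measurableSet_ergodicCodes`). Defining `T` by this condition, and not
as the image of a subset of `X`, is what gives a Borel set and not merely an analytic one.
-/

open MeasureTheory ProbabilityTheory

/-! ### Harmonic functions along a stationary step -/

section Kernels

variable {X : Type*} [MeasurableSpace X] {e : Kernel X X} [IsMarkovKernel e]

/-- For an idempotent kernel `e`, each function `y ↦ e y A` is harmonic for `e`, and the measure
`e x` is stationary for `e`. So under the two-step law `e x ⊗ₘ e` the square of the increment of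
this function has mean `∫ g² - 2 ∫ g² + ∫ g² = 0`. -/
lemma ae_real_eq_of_idempotent (he : e ∘ₖ e = e) (x : X) {A : Set X} (hA : MeasurableSet A) :
    ∀ᵐ p ∂(e x ⊗ₘ e), (e p.2).real A = (e p.1).real A := by
  set g : X → ℝ := fun y ↦ (e y).real A with hg
  have hgm : Measurable g := (e.measurable_coe hA).ennreal_toReal
  have hg0 (y : X) : 0 ≤ g y := measureReal_nonneg
  have hg1 (y : X) : g y ≤ 1 := measureReal_le_one
  have hst : e ∘ₘ e x = e x := by rw [← Kernel.comp_apply, he]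
  have harm (y : X) : ∫ z, g z ∂e y = g y := by
    have h : e y A = ∫⁻ z, e z A ∂e y := by
      conv_lhs => rw [← he, Kernel.comp_apply' _ _ _ hA]
    rw [integral_eq_lintegral_of_nonneg_ae (.of_forall hg0) hgm.aestronglyMeasurable]
    simp only [hg, measureReal_def]
    rw [h]
    congr 1
    exact lintegral_congr fun z ↦ ENNReal.ofReal_toReal (measure_ne_top _ _)
  have hbdd {f : X × X → ℝ} (hf : Measurable f) (hf1 : ∀ p, ‖f p‖ ≤ 1) :
      Integrable f (e x ⊗ₘ e) :=
    Integrable.of_bound hf.aestronglyMeasurable 1 (.of_forall hf1)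
  have hprod (y z : X) : ‖g y * g z‖ ≤ 1 := by
    rw [Real.norm_of_nonneg (mul_nonneg (hg0 y) (hg0 z))]
    exact mul_le_one₀ (hg1 y) (hg0 z) (hg1 z)
  have i22 : Integrable (fun p : X × X ↦ g p.2 * g p.2) (e x ⊗ₘ e) :=
    hbdd (by fun_prop) fun p ↦ hprod _ _
  have i12 : Integrable (fun p : X × X ↦ g p.1 * g p.2) (e x ⊗ₘ e) :=
    hbdd (by fun_prop) fun p ↦ hprod _ _
  have i11 : Integrable (fun p : X × X ↦ g p.1 * g p.1) (e x ⊗ₘ e) :=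
    hbdd (by fun_prop) fun p ↦ hprod _ _
  have h22 : ∫ p, g p.2 * g p.2 ∂(e x ⊗ₘ e) = ∫ y, g y * g y ∂e x := by
    have h := integral_map (μ := e x ⊗ₘ e) (φ := Prod.snd) measurable_snd.aemeasurable
      (f := fun y ↦ g y * g y) (by fun_prop)
    rw [← h, ← Measure.snd, Measure.snd_compProd, hst]
  have h11 : ∫ p, g p.1 * g p.1 ∂(e x ⊗ₘ e) = ∫ y, g y * g y ∂e x := by
    rw [Measure.integral_compProd i11]
    simp
  have h12 : ∫ p, g p.1 * g p.2 ∂(e x ⊗ₘ e) = ∫ y, g y * g y ∂e x := by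
    rw [Measure.integral_compProd i12]
    simp only [integral_const_mul, harm]
  have hzero : ∫ p, (g p.2 - g p.1) ^ 2 ∂(e x ⊗ₘ e) = 0 := by
    have h (p : X × X) : (g p.2 - g p.1) ^ 2 =
        g p.2 * g p.2 - 2 * (g p.1 * g p.2) + g p.1 * g p.1 := by ring
    simp only [h]
    have h' : ∫ p, (g p.2 * g p.2 - 2 * (g p.1 * g p.2)) ∂(e x ⊗ₘ e) =
        ∫ y, g y * g y ∂e x - 2 * ∫ y, g y * g y ∂e x := by
      rw [integral_sub i22 (i12.const_mul 2), integral_const_mul, h22, h12]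
    rw [integral_add (by exact i22.sub (i12.const_mul 2)) i11, h', h11]
    ring
  have hint : Integrable (fun p : X × X ↦ (g p.2 - g p.1) ^ 2) (e x ⊗ₘ e) := by
    refine hbdd (by fun_prop) fun p ↦ ?_
    rw [Real.norm_of_nonneg (sq_nonneg _), sq_le_one_iff_abs_le_one, abs_le]
    constructor <;> linarith [hg0 p.1, hg0 p.2, hg1 p.1, hg1 p.2]
  filter_upwards [(integral_eq_zero_iff_of_nonneg (fun p ↦ sq_nonneg _) hint).1 hzero] with p hp
  exact sub_eq_zero.1 (pow_eq_zero_iff two_ne_zero |>.1 hp)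

end Kernels

/-! ### Measures on the real line encoded by distribution functions -/

section Codes

/-- A space of codes for probability measures on `ℝ`: a measure is encoded by the values of its
cumulative distribution function at the rational numbers. The index set is lifted so that the
codes live in an arbitrary universe. -/
abbrev RatCDF : Type u := ULift.{u} ℚ → ℝ

lemma measurable_ratCDF_eval : Measurable fun (F : RatCDF.{u}) (q : ℚ) ↦ F ⟨q⟩ := by
  fun_prop

/-- Decoding of `RatCDF` as a Markov kernel. Codes which do not come from a probability measure
are sent to a default value. -/
noncomputable def decodeKernel : Kernel RatCDF.{u} ℝ where
  toFun F := (stieltjesOfMeasurableRat _ measurable_ratCDF_eval F).measure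
  measurable' := measurable_measure_stieltjesOfMeasurableRat _

instance : IsMarkovKernel decodeKernel.{u} :=
  ⟨fun F ↦ ⟨measure_stieltjesOfMeasurableRat_univ measurable_ratCDF_eval F⟩⟩

lemma decodeKernel_cdf (μ : Measure ℝ) [IsProbabilityMeasure μ] :
    decodeKernel.{u} (fun q ↦ cdf μ q.down) = μ := by
  have hp : IsRatStieltjesPoint (fun (F : RatCDF.{u}) q ↦ F ⟨q⟩) (fun q ↦ cdf μ q.down) := by
    refine ⟨fun q r h ↦ monotone_cdf μ (by exact_mod_cast h),
      (tendsto_cdf_atTop μ).comp (tendsto_ratCast_atTop_iff.2 Filter.tendsto_id),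
      (tendsto_cdf_atBot μ).comp (tendsto_ratCast_atBot_iff.2 Filter.tendsto_id), fun q ↦ ?_⟩
    refine Eq.trans ?_ (StieltjesFunction.iInf_rat_gt_eq (cdf μ) q)
    exact Equiv.iInf_congr (Equiv.subtypeEquivRight fun r ↦ by simp) fun r ↦ rfl
  refine Measure.ext_of_Iic _ _ fun a ↦ ?_
  change (stieltjesOfMeasurableRat _ measurable_ratCDF_eval _).measure (Set.Iic a) = _
  rw [measure_stieltjesOfMeasurableRat_Iic, ← ofReal_cdf μ a,
    ← StieltjesFunction.iInf_rat_gt_eq (cdf μ), ← StieltjesFunction.iInf_rat_gt_eq]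
  congr 1
  refine iInf_congr fun r ↦ ?_
  rw [stieltjesOfMeasurableRat_eq, toRatCDF_of_isRatStieltjesPoint hp]

end Codes

/-! ### Idempotent kernels on standard Borel spaces -/

section Splitting

variable {X : Type u} [MeasurableSpace X] [StandardBorelSpace X]

/-- The code of the measure `e y`, transported to `ℝ` along a measurable embedding of `X`. -/
noncomputable def lawCode (e : Kernel X X) (y : X) : RatCDF.{u} :=
  fun q ↦ cdf ((e y).map (embeddingReal X)) q.down

/-- The codes of the measures `ν` such that `e z = ν` for `ν`-almost every `z`. These are the
ergodic components of `e`, and they form the space through which `e` splits. -/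
def ergodicCodes (e : Kernel X X) : Set RatCDF.{u} :=
  {F | decodeKernel F (embeddingReal X '' {z | lawCode e z = F}) = 1}

/-- In particular, the default values of `decodeKernel` at codes which come from no measure do not
contribute to `ergodicCodes`. -/
lemma exists_lawCode_eq_of_mem_ergodicCodes {e : Kernel X X} {F : RatCDF.{u}}
    (hF : F ∈ ergodicCodes e) :
    ∃ y, lawCode e y = F := by
  by_contra! h
  have h0 : {z | lawCode e z = F} = ∅ := Set.eq_empty_of_forall_notMem h
  simp [ergodicCodes, h0] at hF

variable (e : Kernel X X) [IsMarkovKernel e]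

lemma lawCode_apply (y : X) (q : ULift.{u} ℚ) :
    lawCode e y q = (e y).real (embeddingReal X ⁻¹' Set.Iic (q.down : ℝ)) := by
  have := Measure.isProbabilityMeasure_map (μ := e y) (measurable_embeddingReal X).aemeasurable
  rw [lawCode, cdf_eq_real,
    map_measureReal_apply (measurable_embeddingReal X) measurableSet_Iic]

lemma measurable_lawCode : Measurable (lawCode e) := by
  refine measurable_pi_lambda _ fun q ↦ ?_
  simp only [lawCode_apply]
  exact (e.measurable_coe (measurable_embeddingReal X measurableSet_Iic)).ennreal_toReal

lemma decodeKernel_lawCode (y : X) :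
    decodeKernel (lawCode e y) = (e y).map (embeddingReal X) := by
  have := Measure.isProbabilityMeasure_map (μ := e y) (measurable_embeddingReal X).aemeasurable
  exact decodeKernel_cdf _

lemma comapRight_decodeKernel_lawCode (y : X) :
    decodeKernel.comapRight (measurableEmbedding_embeddingReal X) (lawCode e y) = e y := by
  rw [Kernel.comapRight_apply, decodeKernel_lawCode,
    (measurableEmbedding_embeddingReal X).comap_map]

lemma eq_of_lawCode_eq {y z : X} (h : lawCode e z = lawCode e y) : e z = e y := by
  rw [← comapRight_decodeKernel_lawCode e z, h, comapRight_decodeKernel_lawCode]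

variable {e} in
lemma ae_ae_lawCode_eq (he : e ∘ₖ e = e) (x : X) :
    ∀ᵐ y ∂e x, ∀ᵐ z ∂e y, lawCode e z = lawCode e y := by
  refine Measure.ae_ae_of_ae_compProd (p := fun p ↦ lawCode e p.2 = lawCode e p.1) ?_
  have h := ae_all_iff.2 fun q : ULift.{u} ℚ ↦ ae_real_eq_of_idempotent he x
    (measurable_embeddingReal X (measurableSet_Iic (a := (q.down : ℝ))))
  filter_upwards [h] with p hp
  ext q
  rw [lawCode_apply, lawCode_apply, hp]

variable {e} in
/-- The point drawn from `e x` may equally be drawn in two steps, first `y` from `e x` and then `z`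
from `e y`. The left-hand side is then the mixture of `e z ⊗ δ_z`, which almost surely equals
`e y ⊗ δ_z`; integrating out `z` gives `e y ⊗ e y`. -/
theorem balanced_of_idempotent (he : e ∘ₖ e = e) :
    (e ∥ₖ Kernel.id) ∘ₖ Kernel.copy X ∘ₖ e = (e ∥ₖ e) ∘ₖ Kernel.copy X ∘ₖ e := by
  have key (κ : Kernel X X) [IsMarkovKernel κ] (y : X) {s : Set (X × X)} (hs : MeasurableSet s) :
      ((e ∥ₖ κ) ∘ₖ Kernel.copy X) y s = ∫⁻ w, e y ((fun v ↦ (v, w)) ⁻¹' s) ∂κ y := by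
    rw [Kernel.comp_apply, Kernel.copy_apply, Measure.dirac_bind (Kernel.measurable _),
      Kernel.parallelComp_apply, Measure.prod_apply_symm hs]
  ext x s hs
  have htwo : ∫⁻ y, ((e ∥ₖ Kernel.id) ∘ₖ Kernel.copy X) y s ∂e x =
      ∫⁻ y, ∫⁻ z, ((e ∥ₖ Kernel.id) ∘ₖ Kernel.copy X) z s ∂e y ∂e x := by
    rw [← Kernel.lintegral_comp _ _ _ (Kernel.measurable_coe _ hs), he]
  rw [Kernel.comp_apply' _ _ _ hs, Kernel.comp_apply' _ _ _ hs, htwo]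
  refine lintegral_congr_ae ?_
  filter_upwards [ae_ae_lawCode_eq he x] with y hy
  rw [key e y hs]
  refine lintegral_congr_ae ?_
  filter_upwards [hy] with z hz
  rw [key Kernel.id z hs, Kernel.id_apply, eq_of_lawCode_eq e hz,
    lintegral_dirac' _ (measurable_measure_prodMk_right hs)]

lemma measurableSet_ergodicCodes : MeasurableSet (ergodicCodes e) := by
  have hD : MeasurableSet {p : RatCDF.{u} × X | lawCode e p.2 = p.1} :=
    measurableSet_eq_fun ((measurable_lawCode e).comp measurable_snd) measurable_fst
  have hD' := (MeasurableEmbedding.id.prodMap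
    (measurableEmbedding_embeddingReal X)).measurableSet_image.2 hD
  have h := Kernel.measurable_kernel_prodMk_left (κ := decodeKernel.{u}) hD'
  convert h (measurableSet_singleton 1) using 1
  ext F
  have : Prod.mk F ⁻¹' (Prod.map id (embeddingReal X) '' {p | lawCode e p.2 = p.1}) =
      embeddingReal X '' {z | lawCode e z = F} := by
    ext r
    simp
  simp [ergodicCodes, this]

lemma lawCode_mem_ergodicCodes_iff {y : X} :
    lawCode e y ∈ ergodicCodes e ↔ ∀ᵐ z ∂e y, lawCode e z = lawCode e y := by
  have hm : MeasurableSet {z | lawCode e z = lawCode e y} :=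
    measurable_lawCode e (measurableSet_singleton _)
  change decodeKernel _ _ = 1 ↔ _
  rw [decodeKernel_lawCode, (measurableEmbedding_embeddingReal X).map_apply,
    (measurableEmbedding_embeddingReal X).injective.preimage_image]
  exact (mem_ae_iff_prob_eq_one hm).symm

variable {e} in
lemma map_lawCode_eq_dirac {y : X} (hy : lawCode e y ∈ ergodicCodes e) :
    (e y).map (lawCode e) = Measure.dirac (lawCode e y) := by
  rw [Measure.map_congr ((lawCode_mem_ergodicCodes_iff e).1 hy), Measure.map_const]
  simp

variable {e} in
/-- The splitting is through the space of ergodic components: `π` runs `e` and records the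
component of the result, and `ι` samples from a component. -/
theorem exists_splitting_of_idempotent (he : e ∘ₖ e = e) :
    ∃ (T : Type u) (_ : MeasurableSpace T) (_ : StandardBorelSpace T)
      (π : Kernel X T) (ι : Kernel T X), IsMarkovKernel π ∧ IsMarkovKernel ι ∧
      π ∘ₖ ι = Kernel.id ∧ ι ∘ₖ π = e := by
  have hS := measurableSet_ergodicCodes e
  have hc := measurable_lawCode e
  have hval := MeasurableEmbedding.subtype_coe hS
  have hmem (x : X) : ∀ᵐ F ∂(e.map (lawCode e) x), F ∈ ergodicCodes e := by
    rw [Kernel.map_apply _ hc]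
    refine (ae_map_iff hc.aemeasurable hS).2 ?_
    filter_upwards [ae_ae_lawCode_eq he x] with y hy
    exact (lawCode_mem_ergodicCodes_iff e).2 hy
  let π : Kernel X (ergodicCodes e) := (e.map (lawCode e)).comapRight hval
  let ι : Kernel (ergodicCodes e) X :=
    (decodeKernel.comapRight (measurableEmbedding_embeddingReal X)).comap _ measurable_subtype_coe
  have hι (F : ergodicCodes e) (y : X) (hy : lawCode e y = F) : ι F = e y := by
    rw [Kernel.comap_apply, ← hy, comapRight_decodeKernel_lawCode]
  have := Kernel.IsMarkovKernel.map e hc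
  refine ⟨ergodicCodes e, inferInstance, hS.standardBorel, π, ι, ?_, ?_, ?_, ?_⟩
  · refine Kernel.IsMarkovKernel.comapRight _ hval fun x ↦ ?_
    rw [Subtype.range_coe]
    exact (mem_ae_iff_prob_eq_one hS).1 (hmem x)
  · refine ⟨fun F ↦ ?_⟩
    obtain ⟨y, hy⟩ := exists_lawCode_eq_of_mem_ergodicCodes F.2
    rw [hι F y hy]
    infer_instance
  · ext F B hB
    obtain ⟨y, hy⟩ := exists_lawCode_eq_of_mem_ergodicCodes F.2
    have hB' := hval.measurableSet_image.2 hB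
    calc (π ∘ₖ ι) F B
        = ∫⁻ z, e z (lawCode e ⁻¹' (Subtype.val '' B)) ∂e y := by
          rw [Kernel.comp_apply' _ _ _ hB, hι F y hy]
          refine lintegral_congr fun z ↦ ?_
          rw [Kernel.comapRight_apply' _ _ _ hB, Kernel.map_apply' _ hc _ hB']
      _ = (e y).map (lawCode e) (Subtype.val '' B) := by
          rw [← Kernel.comp_apply' _ _ _ (hc hB'), he, Measure.map_apply hc hB']
      _ = Kernel.id F B := by
          rw [map_lawCode_eq_dirac (hy ▸ F.2), hy, Kernel.id_apply,
            Measure.dirac_apply' _ hB', Measure.dirac_apply' _ hB]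
          have h : (F : RatCDF.{u}) ∈ Subtype.val '' B ↔ F ∈ B :=
            Subtype.val_injective.mem_set_image
          by_cases hF : F ∈ B
          · rw [Set.indicator_of_mem hF, Set.indicator_of_mem (h.2 hF)]
            rfl
          · rw [Set.indicator_of_notMem hF, Set.indicator_of_notMem (mt h.1 hF)]
  · ext x A hA
    have hd := Kernel.measurable_coe
      (decodeKernel.comapRight (measurableEmbedding_embeddingReal X)) hA
    calc (ι ∘ₖ π) x A
        = ∫⁻ F in ergodicCodes e, decodeKernel.comapRight
            (measurableEmbedding_embeddingReal X) F A ∂(e.map (lawCode e) x) := by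
          rw [Kernel.comp_apply' _ _ _ hA, ← lintegral_subtype_comap hS]
          rfl
      _ = ∫⁻ y, e y A ∂e x := by
          rw [Measure.restrict_eq_self_of_ae_mem (hmem x), Kernel.map_apply _ hc,
            lintegral_map hd hc]
          simp only [comapRight_decodeKernel_lawCode]
      _ = e x A := by rw [← Kernel.comp_apply' _ _ _ hA, he]

end Splitting

/-! ### Passage to the category -/

namespace BorelStoch

/-- The kernel underlying a morphism of `BorelStoch`. -/
abbrev kernel {X Y : BorelStoch.{u}} (f : X ⟶ Y) :
    Kernel X.obj.obj.carrier Y.obj.obj.carrier := f.hom.hom.hom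

lemma hom_ext_kernel {X Y : BorelStoch.{u}} {f g : X ⟶ Y} (h : kernel f = kernel g) : f = g :=
  ObjectProperty.hom_ext _ (WideSubcategory.hom_ext _ (SFinKer.hom_ext h))

lemma kernel_tensorHom {X Y Z W : BorelStoch.{u}} (f : X ⟶ Y) (g : Z ⟶ W) :
    kernel (f ⊗ₘ g) = kernel f ∥ₖ kernel g :=
  Kernel.id_parallelComp_comp_parallelComp_id

end BorelStoch

open BorelStoch in
theorem mainTheorem1 (X : BorelStoch.{u}) (e : X ⟶ X) (he : e ≫ e = e) :
    IsBalanced e ∧ Splits e := by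
  have : StandardBorelSpace X.obj.obj.carrier := X.property
  have : IsMarkovKernel (kernel e) := e.hom.property
  have hk : kernel e ∘ₖ kernel e = kernel e := congrArg kernel he
  constructor
  · refine hom_ext_kernel ?_
    change kernel (e ⊗ₘ 𝟙 X) ∘ₖ Kernel.copy _ ∘ₖ kernel e =
      kernel (e ⊗ₘ e) ∘ₖ Kernel.copy _ ∘ₖ kernel e
    rw [kernel_tensorHom, kernel_tensorHom]
    exact balanced_of_idempotent hk
  · obtain ⟨T, _, hT, π, ι, hπ, hι, hιπ, hπι⟩ := exists_splitting_of_idempotent hk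
    let T' : BorelStoch.{u} := ⟨⟨SFinKer.of T⟩, hT⟩
    let π' : X ⟶ T' := ObjectProperty.homMk ⟨⟨π, inferInstance⟩, hπ⟩
    let ι' : T' ⟶ X := ObjectProperty.homMk ⟨⟨ι, inferInstance⟩, hι⟩
    exact ⟨T', π', ι', hom_ext_kernel hιπ, hom_ext_kernel hπι⟩
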